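/- Let $H=L^2((0,1);\mathbb C)$, let $\mu\in L^\infty(0,1)$ be real-valued with $\|\mu\|:=\|\mu\|_{L^\infty(0,1)}$ (which is the norm of the operator of multiplication by $\mu$ on $H$), and consider the bilinear Schrödinger equation $i\psi_t=-\psi_{zz}-u(t)\mu(z)\psi$ on $(0,1)$ with $\psi(t,0)=\psi(t,1)=0$, that is, the control system $$\dot\phi(t)=A\phi(t)+u(t)B\phi(t),\qquad \phi(0)=\phi_0\in H,$$ where $A\phi=i\phi''$ with $D(A)=H^2((0,1);\mathbb C)\cap H^1_0((0,1);\mathbb C)$, and $B\phi=i\mu\phi$. Let $T>0$, let $K$ be a nonempty subset of the real space $L^2(0,T)$, and let $r\ge 0$ be such that $\|u\|_{L^2(0,T)}\le r$ for all $u\in K$. Let $\mathcal R_T(\phi_0)\subset H$ be the set of all endpoints $\phi(T)$ of mild solutions $\phi\in C([0,T];H)$ of this system with $\phi(0)=\phi_0$ and $u\in K$; here $\phi$ is a mild solution if, for every $t\in[0,T]$, $\int_0^t\phi(s)\,ds\in D(A)$ and $\phi(t)=\phi_0+A\int_0^t\phi(s)\,ds+\int_0^tu(s)B\phi(s)\,ds$.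 For a subset $S$ of a normed space $X$ put $$d_n(S)_X=\inf_{W}\ \sup_{x\in S}\ \inf_{\xi\in W}\|x-\xi\|_X,$$ where $W$ runs over the affine subspaces of $X$ of dimension at most $n$. If $T\|\mu\|^2r^2<1$, then for every $\phi_0\in H$ and every $n\in\mathbb N$ $$d_n(\mathcal R_T(\phi_0))_H\le\|\mu\|\,\|\phi_0\|\sqrt T\,d_n(K)_{L^2(0,T)}+\frac{\|\mu\|^2\|\phi_0\|\,T\,r^2}{1-\|\mu\|\sqrt T\,r}.$$ This holds both when $H$ is regarded as a real space (real affine subspaces, real dimension) and when it is regarded as a complex space (complex affine subspaces, complex dimension) in the definition of $d_n(\mathcal R_T(\phi_0))_H$. -/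

import Mathlib

open MeasureTheory Set
open scoped ENNReal ContDiff

noncomputable section

/-- The affine Kolmogorov `n`-width `d_n(K)` of a subset `K` of a normed space over `𝕜`: the
infimum, over all (nonempty) affine subspaces `W` of dimension at most `n`, of the supremum over
`x ∈ K` of the distance from `x` to `W`. It takes values in `[0, ∞]`. -/
def affineWidth (𝕜 : Type*) {X : Type*} [NormedField 𝕜] [NormedAddCommGroup X] [NormedSpace 𝕜 X]
    (n : ℕ) (K : Set X) : ℝ≥0∞ :=
  ⨅ (W : AffineSubspace 𝕜 X) (_ : (W : Set X).Nonempty ∧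
      FiniteDimensional 𝕜 W.direction ∧ Module.finrank 𝕜 W.direction ≤ n),
    ⨆ x ∈ K, ⨅ ξ ∈ W, ‖x - ξ‖ₑ

/-- The state space `H = L²((0,1); ℂ)`. -/
abbrev StateSpace : Type := Lp ℂ 2 (volume.restrict (Ioo (0 : ℝ) 1))

/-- The space `L²(0,T)` of real controls. -/
abbrev ControlSpace (T : ℝ) : Type := Lp ℝ 2 (volume.restrict (Ioo (0 : ℝ) T))

/-- The space `L^∞(0,1)` of real, essentially bounded functions, with the essential supremum
norm. -/
abbrev PotentialSpace : Type := Lp ℝ ∞ (volume.restrict (Ioo (0 : ℝ) 1))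

/-- The test functions of class `C_c^∞((0,1); ℂ)`. -/
def IsTestFunction (ζ : ℝ → ℂ) : Prop :=
  ContDiff ℝ ∞ ζ ∧ HasCompactSupport ζ ∧ tsupport ζ ⊆ Ioo (0 : ℝ) 1

/-- `g ∈ L²((0,1); ℂ)` is the weak (distributional) derivative of `f ∈ L²((0,1); ℂ)`. -/
def HasWeakDeriv (f g : StateSpace) : Prop :=
  ∀ ζ : ℝ → ℂ, IsTestFunction ζ →
    ∫ z in Ioo (0 : ℝ) 1, f z * deriv ζ z = - ∫ z in Ioo (0 : ℝ) 1, g z * ζ z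

/-- `f ∈ H¹₀((0,1); ℂ)`: `f` has a weak derivative in `L²` and is a limit of test functions
in the `H¹` norm. -/
def MemH1Zero (f : StateSpace) : Prop :=
  ∃ g : StateSpace, HasWeakDeriv f g ∧ ∀ ε : ℝ≥0∞, 0 < ε → ∃ ζ : ℝ → ℂ, IsTestFunction ζ ∧
    eLpNorm (fun z => f z - ζ z) 2 (volume.restrict (Ioo (0 : ℝ) 1)) ≤ ε ∧
    eLpNorm (fun z => g z - deriv ζ z) 2 (volume.restrict (Ioo (0 : ℝ) 1)) ≤ ε

/-- The graph of the operator `A f = i f''` with domain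
`D(A) = H²((0,1); ℂ) ∩ H¹₀((0,1); ℂ)`: `FreeGenerator f y` says that `f ∈ D(A)` and `A f = y`. -/
def FreeGenerator (f y : StateSpace) : Prop :=
  MemH1Zero f ∧ ∃ g h : StateSpace, HasWeakDeriv f g ∧ HasWeakDeriv g h ∧ y = Complex.I • h

/-- The control operator `B f = i μ f`. -/
def controlOp (μ : PotentialSpace) (f : StateSpace) : StateSpace :=
  Complex.I • ((μ • f : StateSpace))

/-- `φ` is the (mild) solution on `[0,T]` of `φ' = A φ + u(t) B φ`, `φ(0) = φ₀`: it is continuous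
with values in `H`, the integral of `φ` over `[0,t]` belongs to `D(A)`, and
`φ(t) = φ₀ + A ∫₀ᵗ φ(s) ds + ∫₀ᵗ u(s) B φ(s) ds` for every `t ∈ [0,T]`. -/
def IsMildSolution (μ : PotentialSpace) (T : ℝ) (u : ControlSpace T) (φ₀ : StateSpace)
    (φ : ℝ → StateSpace) : Prop :=
  ContinuousOn φ (Icc 0 T) ∧ ∀ t ∈ Icc 0 T, ∃ y : StateSpace,
    FreeGenerator (∫ s in (0 : ℝ)..t, φ s) y ∧
      φ t = φ₀ + y + ∫ s in (0 : ℝ)..t, u s • controlOp μ (φ s)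

/-- The reachable set at time `T` from `φ₀` with controls in `K`. -/
def reachableSet (μ : PotentialSpace) (T : ℝ) (K : Set (ControlSpace T)) (φ₀ : StateSpace) :
    Set StateSpace :=
  {x | ∃ u ∈ K, ∃ φ : ℝ → StateSpace, IsMildSolution μ T u φ₀ φ ∧ φ T = x}

end

/-! To first order in `u`, the end-point map is affine. Let `S(t)` be the unitary group generated by
`A`. In the interaction picture a mild solution satisfies `S(-t)φ(t) = φ₀ + ∫₀ᵗ u(s) S(-s)Bφ(s) ds`.
Replacing `φ(s)` by the free evolution `S(s)φ₀` gives `φ(T) ≈ S(T)(φ₀ + Lu)` with `L` real linear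
and, by Cauchy–Schwarz, `‖Lu‖ ≤ ‖μ‖‖φ₀‖√T‖u‖`. The error contains the control twice: `φ(s) - S(s)φ₀`
is already of size `‖μ‖√T r · sup‖φ‖`, and one more integration against `u` squares the factor. The
supremum is at most `‖φ₀‖/(1 - ‖μ‖√T r)` by absorption (`IsMildSolution.norm_le`). Hence the
reachable set lies within the remainder of an affine image of `K`, and such a map carries
approximating affine subspaces to affine subspaces of no larger dimension
(`affineWidth_le_of_affine_approx`). Existence of solutions plays no role.

The analytic work is the variation of constants formula (`IsMildSolution.freeGroup_neg_apply`),
since `A` is given only through weak derivatives and `H¹₀`. Two integrations by parts against the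
Dirichlet sines make `A` diagonal (`FreeGenerator.inner_dirichletBasis`); completeness of the sines
reduces the mild equation to scalar integral equations, solved with an integrating factor
(`exp_mul_eq_add_integral_of_eq_integral`). -/

/-! ### Smooth cutoffs on the unit interval. -/

open Filter Topology in
theorem Real.smoothTransition.deriv_eq_zero_of_one_lt {x : ℝ} (hx : 1 < x) :
    deriv Real.smoothTransition x = 0 := by
  have : Real.smoothTransition =ᶠ[𝓝 x] fun _ => 1 := by
    filter_upwards [lt_mem_nhds hx] with y hy
    exact Real.smoothTransition.one_of_one_le hy.le
  rw [this.deriv_eq, deriv_const]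

open Filter Topology in
theorem Real.smoothTransition.deriv_eq_zero_of_neg {x : ℝ} (hx : x < 0) :
    deriv Real.smoothTransition x = 0 := by
  have : Real.smoothTransition =ᶠ[𝓝 x] fun _ => 0 := by
    filter_upwards [gt_mem_nhds hx] with y hy
    exact Real.smoothTransition.zero_of_nonpos hy.le
  rw [this.deriv_eq, deriv_const]

/-- The derivative of `unitCutoff n` carries a factor `n + 1`. Against a function of size `z (1 -
z)` this factor becomes `(n + 1) z (1 - z) = x + 1`, where `x` is the argument of the transition, so
the bound is uniform in `n`. -/
theorem Real.smoothTransition.exists_deriv_mul_bound :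
    ∃ M : ℝ, 0 ≤ M ∧ ∀ x, |deriv Real.smoothTransition x| * |x + 1| ≤ M := by
  have hcont : Continuous (deriv Real.smoothTransition) :=
    (Real.smoothTransition.contDiff (n := 1)).continuous_deriv le_rfl
  obtain ⟨M, hM⟩ := (isCompact_Icc (a := (0 : ℝ)) (b := 1)).exists_bound_of_continuousOn
    (f := fun x => |deriv Real.smoothTransition x| * |x + 1|) (by fun_prop)
  have hM0 : 0 ≤ M := (norm_nonneg _).trans (hM 0 (by simp))
  refine ⟨M, hM0, fun x => ?_⟩
  rcases lt_or_ge x 0 with h | h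
  · simpa [Real.smoothTransition.deriv_eq_zero_of_neg h] using hM0
  rcases lt_or_ge 1 x with h' | h'
  · simpa [Real.smoothTransition.deriv_eq_zero_of_one_lt h'] using hM0
  exact (le_abs_self _).trans (hM x ⟨h, h'⟩)

/-- Smooth cutoff equal to `1` where `2 ≤ (n + 1) z (1 - z)` and to `0` where
`(n + 1) z (1 - z) ≤ 1`. -/
noncomputable def unitCutoff (n : ℕ) (z : ℝ) : ℝ :=
  Real.smoothTransition ((n + 1) * (z * (1 - z)) - 1)

theorem contDiff_unitCutoff (n : ℕ) : ContDiff ℝ ∞ (unitCutoff n) := by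
  have : ContDiff ℝ ∞ fun z : ℝ => ((n : ℝ) + 1) * (z * (1 - z)) - 1 := by fun_prop
  exact Real.smoothTransition.contDiff.comp this

theorem hasDerivAt_unitCutoff (n : ℕ) (z : ℝ) :
    HasDerivAt (unitCutoff n)
      (deriv Real.smoothTransition ((n + 1) * (z * (1 - z)) - 1) * ((n + 1) * (1 - 2 * z))) z := by
  have h1 : HasDerivAt (fun z : ℝ => ((n : ℝ) + 1) * (z * (1 - z)) - 1)
      (((n : ℝ) + 1) * (1 - 2 * z)) z := by
    have := (((hasDerivAt_id z).mul ((hasDerivAt_id z).const_sub 1)).const_mul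
      ((n : ℝ) + 1)).sub_const 1
    convert! this using 1
    simp only [id]
    ring
  have h2 : HasDerivAt Real.smoothTransition
      (deriv Real.smoothTransition ((n + 1) * (z * (1 - z)) - 1)) ((n + 1) * (z * (1 - z)) - 1) :=
    ((Real.smoothTransition.contDiff (n := 1)).differentiable one_ne_zero).differentiableAt.hasDerivAt
  exact h2.comp z h1

theorem tsupport_unitCutoff_subset (n : ℕ) :
    tsupport (unitCutoff n) ⊆ {z : ℝ | 1 ≤ (n + 1) * (z * (1 - z))} := by
  refine closure_minimal (fun z hz => ?_) (isClosed_le (by fun_prop) (by fun_prop))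
  by_contra h
  simp only [mem_ofPred_eq, not_le] at h
  exact hz (Real.smoothTransition.zero_of_nonpos (by linarith))

theorem tsupport_unitCutoff_subset_Ioo (n : ℕ) : tsupport (unitCutoff n) ⊆ Ioo (0 : ℝ) 1 := by
  intro z hz
  have h : 1 ≤ ((n : ℝ) + 1) * (z * (1 - z)) := tsupport_unitCutoff_subset n hz
  have hn : (0 : ℝ) < n + 1 := by positivity
  have h2 : 0 < z * (1 - z) := by
    by_contra hc
    nlinarith
  constructor <;> by_contra hc <;> nlinarith

theorem isTestFunction_unitCutoff_mul (n : ℕ) {e : ℝ → ℝ} (he : ContDiff ℝ ∞ e) :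
    IsTestFunction fun z => ((unitCutoff n z * e z : ℝ) : ℂ) := by
  have hsupp : tsupport (fun z => ((unitCutoff n z * e z : ℝ) : ℂ)) ⊆ tsupport (unitCutoff n) := by
    refine closure_mono fun z hz => ?_
    simp only [Function.mem_support, ne_eq, Complex.ofReal_eq_zero, mul_eq_zero, not_or] at hz
    exact hz.1
  have hc : HasCompactSupport (fun z => ((unitCutoff n z * e z : ℝ) : ℂ)) := by
    refine (isCompact_Icc (a := (0 : ℝ)) (b := 1)).of_isClosed_subset (isClosed_tsupport _) ?_
    exact hsupp.trans ((tsupport_unitCutoff_subset_Ioo n).trans Ioo_subset_Icc_self)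
  refine ⟨?_, hc, hsupp.trans (tsupport_unitCutoff_subset_Ioo n)⟩
  exact Complex.ofRealCLM.contDiff.comp ((contDiff_unitCutoff n).mul he)

/-! ### Weak derivatives and integration by parts. -/

theorem StateSpace.integrable (f : StateSpace) :
    Integrable f (volume.restrict (Ioo (0 : ℝ) 1)) :=
  (Lp.memLp f).integrable (by norm_num)

open Filter Topology in
theorem eventually_two_lt_mul {z : ℝ} (hz : z ∈ Ioo (0 : ℝ) 1) :
    ∀ᶠ n : ℕ in atTop, 1 < ((n : ℝ) + 1) * (z * (1 - z)) - 1 := by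
  have hw : 0 < z * (1 - z) := mul_pos hz.1 (by linarith [hz.2])
  have : Tendsto (fun n : ℕ => ((n : ℝ) + 1) * (z * (1 - z)) - 1) atTop atTop :=
    tendsto_atTop_add_const_right _ _
      ((tendsto_atTop_add_const_right _ _ tendsto_natCast_atTop_atTop).atTop_mul_const hw)
  exact this.eventually_gt_atTop 1

-- The weak derivative is tested with `unitCutoff n * e`. Nothing is known about `g` at the
-- endpoints, so `e` has to vanish there: the term with the derivative of the cutoff is then bounded
-- by `C * M` for all `n`, is eventually zero at each point, and disappears by dominated
-- convergence.
open Filter Topology in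
theorem HasWeakDeriv.integral_mul_deriv_of_abs_le {g h : StateSpace} (hgh : HasWeakDeriv g h)
    {e : ℝ → ℝ} (he : ContDiff ℝ ∞ e) {C : ℝ} (hC : 0 ≤ C)
    (heC : ∀ z ∈ Ioo (0 : ℝ) 1, |e z| ≤ C * (z * (1 - z))) :
    ∫ z in Ioo (0 : ℝ) 1, g z * ((deriv e z : ℝ) : ℂ) = - ∫ z in Ioo (0 : ℝ) 1, h z * (e z : ℂ) := by
  obtain ⟨M, hM0, hM⟩ := Real.smoothTransition.exists_deriv_mul_bound
  have he' : Continuous (deriv e) := he.continuous_deriv (by simp)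
  obtain ⟨D, hD⟩ := (isCompact_Icc (a := (0 : ℝ)) (b := 1)).exists_bound_of_continuousOn
    he'.continuousOn
  set ζ : ℕ → ℝ → ℂ := fun n z => ((unitCutoff n z * e z : ℝ) : ℂ) with hζ
  have hζd : ∀ n z, HasDerivAt (ζ n)
      (((deriv Real.smoothTransition ((n + 1) * (z * (1 - z)) - 1) * ((n + 1) * (1 - 2 * z)) * e z
        + unitCutoff n z * deriv e z : ℝ)) : ℂ) z := fun n z =>
    ((hasDerivAt_unitCutoff n z).mul
      ((he.differentiable (by simp)).differentiableAt.hasDerivAt)).ofReal_comp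
  have hcut : ∀ n z, |unitCutoff n z| ≤ 1 := fun n z => by
    rw [unitCutoff, abs_of_nonneg (Real.smoothTransition.nonneg _)]
    exact Real.smoothTransition.le_one _
  have lim1 : Tendsto (fun n => ∫ z in Ioo (0 : ℝ) 1, g z * deriv (ζ n) z) atTop
      (𝓝 (∫ z in Ioo (0 : ℝ) 1, g z * ((deriv e z : ℝ) : ℂ))) := by
    refine tendsto_integral_of_dominated_convergence (fun z => ‖g z‖ * (C * M + D)) ?_ ?_ ?_ ?_
    · intro n
      refine (StateSpace.integrable g).aestronglyMeasurable.mul ?_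
      exact ((isTestFunction_unitCutoff_mul n he).1.continuous_deriv
        (by simp)).aestronglyMeasurable
    · exact (StateSpace.integrable g).norm.mul_const _
    · intro n
      filter_upwards [ae_restrict_mem measurableSet_Ioo] with z hz
      rw [(hζd n z).deriv, norm_mul, Complex.norm_real, Real.norm_eq_abs]
      gcongr
      refine (abs_add_le _ _).trans ?_
      gcongr
      · set x : ℝ := (n + 1) * (z * (1 - z)) - 1 with hx
        have h1 : |1 - 2 * z| ≤ 1 := abs_le.2 ⟨by linarith [hz.2], by linarith [hz.1]⟩
        have hw : 0 ≤ z * (1 - z) := mul_nonneg hz.1.le (by linarith [hz.2])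
        have h2 : |x + 1| = (n + 1) * (z * (1 - z)) := by
          rw [hx, sub_add_cancel, abs_of_nonneg (by positivity)]
        have h3 : |((n : ℝ) + 1)| = n + 1 := abs_of_nonneg (by positivity)
        rw [abs_mul, abs_mul, abs_mul, h3]
        calc |deriv Real.smoothTransition x| * ((n + 1) * |1 - 2 * z|) * |e z|
            ≤ |deriv Real.smoothTransition x| * ((n + 1) * 1) * (C * (z * (1 - z))) := by
              gcongr
              exact heC z hz
          _ = C * (|deriv Real.smoothTransition x| * |x + 1|) := by rw [h2]; ring
          _ ≤ C * M := by gcongr; exact hM x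
      · rw [abs_mul]
        calc |unitCutoff n z| * |deriv e z| ≤ 1 * D := by
              gcongr
              · exact hcut n z
              · exact hD z ⟨hz.1.le, hz.2.le⟩
          _ = D := one_mul D
    · filter_upwards [ae_restrict_mem measurableSet_Ioo] with z hz
      refine tendsto_const_nhds.congr' ?_
      filter_upwards [eventually_two_lt_mul hz] with n hn
      rw [(hζd n z).deriv, Real.smoothTransition.deriv_eq_zero_of_one_lt hn, unitCutoff,
        Real.smoothTransition.one_of_one_le hn.le]
      simp
  have lim2 : Tendsto (fun n => - ∫ z in Ioo (0 : ℝ) 1, h z * ζ n z) atTop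
      (𝓝 (- ∫ z in Ioo (0 : ℝ) 1, h z * (e z : ℂ))) := by
    refine (tendsto_integral_of_dominated_convergence (fun z => ‖h z‖ * C) ?_ ?_ ?_ ?_).neg
    · intro n
      refine (StateSpace.integrable h).aestronglyMeasurable.mul ?_
      exact (isTestFunction_unitCutoff_mul n he).1.continuous.aestronglyMeasurable
    · exact (StateSpace.integrable h).norm.mul_const _
    · intro n
      filter_upwards [ae_restrict_mem measurableSet_Ioo] with z hz
      rw [norm_mul, Complex.norm_real, Real.norm_eq_abs, abs_mul]
      gcongr
      have hw : z * (1 - z) ≤ 1 := by nlinarith [hz.1, hz.2]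
      calc |unitCutoff n z| * |e z| ≤ 1 * (C * 1) := by
            gcongr
            · exact hcut n z
            · exact (heC z hz).trans (by gcongr)
        _ = C := by ring
    · filter_upwards [ae_restrict_mem measurableSet_Ioo] with z hz
      refine tendsto_const_nhds.congr' ?_
      filter_upwards [eventually_two_lt_mul hz] with n hn
      simp only [hζ]
      rw [unitCutoff, Real.smoothTransition.one_of_one_le hn.le, one_mul]
  refine tendsto_nhds_unique lim1 (lim2.congr fun n => ?_)
  exact (hgh _ (isTestFunction_unitCutoff_mul n he)).symm

theorem HasWeakDeriv.unique {f g g' : StateSpace} (h : HasWeakDeriv f g) (h' : HasWeakDeriv f g') :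
    g = g' := by
  have key : ∀ᵐ z : ℝ, z ∈ Ioo (0 : ℝ) 1 → g z - g' z = 0 := by
    refine isOpen_Ioo.ae_eq_zero_of_integral_contDiff_smul_eq_zero
      (IntegrableOn.locallyIntegrableOn
        ((StateSpace.integrable g).sub (StateSpace.integrable g'))) ?_
    intro ζ hζ hζc hζs
    have htest : IsTestFunction fun z => (ζ z : ℂ) := by
      have hsupp : tsupport (fun z => (ζ z : ℂ)) ⊆ tsupport ζ :=
        closure_mono fun z hz => by simpa using hz
      exact ⟨Complex.ofRealCLM.contDiff.comp hζ, hζc.of_isClosed_subset (isClosed_tsupport _) hsupp,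
        hsupp.trans hζs⟩
    have hb : ∃ C, ∀ z, ‖(ζ z : ℂ)‖ ≤ C := htest.1.continuous.bounded_above_of_compact_support
      htest.2.1
    obtain ⟨C, hC⟩ := hb
    have hint : ∀ k : StateSpace, Integrable (fun z => k z * (ζ z : ℂ))
        (volume.restrict (Ioo (0 : ℝ) 1)) := fun k =>
      (StateSpace.integrable k).mul_bdd htest.1.continuous.aestronglyMeasurable
        (ae_of_all _ hC)
    have heq := neg_injective ((h _ htest).symm.trans (h' _ htest))
    have h0 : ∫ z in Ioo (0 : ℝ) 1, ζ z • (g z - g' z) = 0 := by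
      have : ∀ z, ζ z • (g z - g' z) = g z * (ζ z : ℂ) - g' z * (ζ z : ℂ) := fun z => by
        rw [Complex.real_smul]; ring
      simp_rw [this]
      rw [integral_sub (hint g) (hint g'), heq, sub_self]
    rw [← h0]
    symm
    refine setIntegral_eq_integral_of_forall_compl_eq_zero fun z hz => ?_
    have : ζ z = 0 := by
      by_contra hne
      exact hz (hζs (subset_tsupport _ hne))
    rw [this, zero_smul]
  refine Lp.ext ?_
  rw [Filter.EventuallyEq, ae_restrict_iff' measurableSet_Ioo]
  filter_upwards [key] with z hz hmem
  exact sub_eq_zero.1 (hz hmem)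

instance isProbabilityMeasure_restrict_Ioo_zero_one :
    IsProbabilityMeasure (volume.restrict (Ioo (0 : ℝ) 1)) :=
  ⟨by simp⟩

theorem norm_setIntegral_mul_le_of_eLpNorm_le {F p : ℝ → ℂ} {ε : NNReal} {P : ℝ} (hP : 0 ≤ P)
    (hF : AEStronglyMeasurable F (volume.restrict (Ioo (0 : ℝ) 1)))
    (hFε : eLpNorm F 2 (volume.restrict (Ioo (0 : ℝ) 1)) ≤ ε)
    (hp : ∀ z ∈ Ioo (0 : ℝ) 1, ‖p z‖ ≤ P) :
    ‖∫ z in Ioo (0 : ℝ) 1, F z * p z‖ ≤ ε * P := by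
  have h1 : eLpNorm F 1 (volume.restrict (Ioo (0 : ℝ) 1)) ≤ ε :=
    (eLpNorm_le_eLpNorm_of_exponent_le (by norm_num) hF).trans hFε
  have hint : Integrable F (volume.restrict (Ioo (0 : ℝ) 1)) :=
    memLp_one_iff_integrable.1 ⟨hF, h1.trans_lt ENNReal.coe_lt_top⟩
  have h2 : ∫ z in Ioo (0 : ℝ) 1, ‖F z‖ ≤ ε := by
    rw [integral_norm_eq_lintegral_enorm hF, ← eLpNorm_one_eq_lintegral_enorm]
    exact ENNReal.toReal_le_coe_of_le_coe h1
  calc ‖∫ z in Ioo (0 : ℝ) 1, F z * p z‖ ≤ ∫ z in Ioo (0 : ℝ) 1, ‖F z‖ * P := by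
        refine norm_integral_le_of_norm_le (hint.norm.mul_const P) ?_
        filter_upwards [ae_restrict_mem measurableSet_Ioo] with z hz
        rw [norm_mul]
        gcongr
        exact hp z hz
    _ = (∫ z in Ioo (0 : ℝ) 1, ‖F z‖) * P := integral_mul_const _ _
    _ ≤ ε * P := by gcongr

theorem IsTestFunction.integral_deriv_mul {ζ p : ℝ → ℂ} (hζ : IsTestFunction ζ)
    (hp : ContDiff ℝ ∞ p) :
    ∫ z in Ioo (0 : ℝ) 1, deriv ζ z * p z = - ∫ z in Ioo (0 : ℝ) 1, ζ z * deriv p z := by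
  have hζ' : Continuous (deriv ζ) := hζ.1.continuous_deriv (by simp)
  have hp' : Continuous (deriv p) := hp.continuous_deriv (by simp)
  have h0 : ζ 0 = 0 := by
    by_contra hne
    exact lt_irrefl _ (hζ.2.2 (subset_tsupport _ hne)).1
  have h1 : ζ 1 = 0 := by
    by_contra hne
    exact lt_irrefl _ (hζ.2.2 (subset_tsupport _ hne)).2
  have h := intervalIntegral.integral_deriv_mul_eq_sub (a := 0) (b := 1) (u := ζ) (v := p)
    (fun z _ => (hζ.1.differentiable (by simp)).differentiableAt.hasDerivAt)
    (fun z _ => (hp.differentiable (by simp)).differentiableAt.hasDerivAt)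
    (hζ'.intervalIntegrable _ _) (hp'.intervalIntegrable _ _)
  have i1 : IntervalIntegrable (fun z => deriv ζ z * p z) volume 0 1 :=
    (hζ'.mul hp.continuous).intervalIntegrable _ _
  have i2 : IntervalIntegrable (fun z => ζ z * deriv p z) volume 0 1 :=
    (hζ.1.continuous.mul hp').intervalIntegrable _ _
  rw [intervalIntegral.integral_add i1 i2, h0, h1, zero_mul, zero_mul, sub_zero,
    intervalIntegral.integral_of_le zero_le_one, intervalIntegral.integral_of_le zero_le_one,
    integral_Ioc_eq_integral_Ioo, integral_Ioc_eq_integral_Ioo] at h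
  exact eq_neg_of_add_eq_zero_left h

theorem StateSpace.integrable_mul (f : StateSpace) {p : ℝ → ℂ} (hp : Continuous p) :
    Integrable (fun z => f z * p z) (volume.restrict (Ioo (0 : ℝ) 1)) := by
  obtain ⟨P, hP⟩ := (isCompact_Icc (a := (0 : ℝ)) (b := 1)).exists_bound_of_continuousOn
    hp.continuousOn
  refine (StateSpace.integrable f).mul_bdd (c := P) hp.aestronglyMeasurable ?_
  filter_upwards [ae_restrict_mem measurableSet_Ioo] with z hz
  exact hP z (Ioo_subset_Icc_self hz)

/-- Here `p` is free at the endpoints; the boundary terms vanish because of `f`. For test functions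
the identity is classical, and both sides are continuous in the `H¹` norm, in which `f` is a limit
of test functions. -/
theorem MemH1Zero.exists_integral_mul {f : StateSpace} (hf : MemH1Zero f) :
    ∃ g : StateSpace, HasWeakDeriv f g ∧ ∀ p : ℝ → ℂ, ContDiff ℝ ∞ p →
      ∫ z in Ioo (0 : ℝ) 1, g z * p z = - ∫ z in Ioo (0 : ℝ) 1, f z * deriv p z := by
  obtain ⟨g, hfg, happ⟩ := hf
  refine ⟨g, hfg, fun p hp => ?_⟩
  have hp' : Continuous (deriv p) := hp.continuous_deriv (by simp)
  obtain ⟨P, hP⟩ := (isCompact_Icc (a := (0 : ℝ)) (b := 1)).exists_bound_of_continuousOn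
    hp.continuous.continuousOn
  obtain ⟨Q, hQ⟩ := (isCompact_Icc (a := (0 : ℝ)) (b := 1)).exists_bound_of_continuousOn
    hp'.continuousOn
  have hP0 : 0 ≤ P := (norm_nonneg _).trans (hP 0 (by simp))
  have hQ0 : 0 ≤ Q := (norm_nonneg _).trans (hQ 0 (by simp))
  have key : ∀ ε : NNReal, 0 < ε → ‖(∫ z in Ioo (0 : ℝ) 1, g z * p z)
      + ∫ z in Ioo (0 : ℝ) 1, f z * deriv p z‖ ≤ ε * (P + Q) := by
    intro ε hε
    obtain ⟨ζ, hζ, h1, h2⟩ := happ ε (by exact_mod_cast hε)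
    have hζ' : Continuous (deriv ζ) := hζ.1.continuous_deriv (by simp)
    have hint : ∀ {u v : ℝ → ℂ}, Continuous u → Continuous v →
        Integrable (fun z => u z * v z) (volume.restrict (Ioo (0 : ℝ) 1)) := fun hu hv =>
      ((hu.mul hv).continuousOn.integrableOn_compact isCompact_Icc).mono_set Ioo_subset_Icc_self
    have e1 : ∫ z in Ioo (0 : ℝ) 1, (g z - deriv ζ z) * p z
        = (∫ z in Ioo (0 : ℝ) 1, g z * p z) - ∫ z in Ioo (0 : ℝ) 1, deriv ζ z * p z := by
      simp_rw [sub_mul]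
      exact integral_sub (StateSpace.integrable_mul g hp.continuous) (hint hζ' hp.continuous)
    have e2 : ∫ z in Ioo (0 : ℝ) 1, (f z - ζ z) * deriv p z
        = (∫ z in Ioo (0 : ℝ) 1, f z * deriv p z) - ∫ z in Ioo (0 : ℝ) 1, ζ z * deriv p z := by
      simp_rw [sub_mul]
      exact integral_sub (StateSpace.integrable_mul f hp') (hint hζ.1.continuous hp')
    have e3 := hζ.integral_deriv_mul hp
    have e4 : (∫ z in Ioo (0 : ℝ) 1, g z * p z) + ∫ z in Ioo (0 : ℝ) 1, f z * deriv p z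
        = (∫ z in Ioo (0 : ℝ) 1, (g z - deriv ζ z) * p z)
          + ∫ z in Ioo (0 : ℝ) 1, (f z - ζ z) * deriv p z := by
      rw [e1, e2, e3]; ring
    rw [e4, mul_add]
    refine (norm_add_le _ _).trans (add_le_add ?_ ?_)
    · exact norm_setIntegral_mul_le_of_eLpNorm_le hP0
        ((Lp.aestronglyMeasurable g).sub hζ'.aestronglyMeasurable) h2
        fun z hz => hP z (Ioo_subset_Icc_self hz)
    · exact norm_setIntegral_mul_le_of_eLpNorm_le hQ0
        ((Lp.aestronglyMeasurable f).sub hζ.1.continuous.aestronglyMeasurable) h1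
        fun z hz => hQ z (Ioo_subset_Icc_self hz)
  refine eq_neg_of_add_eq_zero_left (norm_le_zero_iff.1 ?_)
  refine le_of_forall_pos_le_add fun δ hδ => ?_
  -- The summand `1` keeps the divisor positive when `P + Q = 0`.
  have hPQ : 0 < P + Q + 1 := by linarith
  have h1 := key (δ / (P + Q + 1)).toNNReal (Real.toNNReal_pos.2 (by positivity))
  rw [Real.coe_toNNReal _ (by positivity), div_mul_eq_mul_div] at h1
  refine h1.trans ?_
  rw [zero_add, div_le_iff₀ hPQ]
  nlinarith

/-- An `H²` function in `H¹₀` can be integrated by parts twice against a smooth function that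
vanishes at both endpoints. -/
theorem MemH1Zero.integral_second_weakDeriv_mul {f g h : StateSpace} (hf : MemH1Zero f)
    (hfg : HasWeakDeriv f g) (hgh : HasWeakDeriv g h) {e : ℝ → ℝ} (he : ContDiff ℝ ∞ e) {C : ℝ}
    (hC : 0 ≤ C) (heC : ∀ z ∈ Ioo (0 : ℝ) 1, |e z| ≤ C * (z * (1 - z))) :
    ∫ z in Ioo (0 : ℝ) 1, h z * (e z : ℂ)
      = ∫ z in Ioo (0 : ℝ) 1, f z * ((deriv (deriv e) z : ℝ) : ℂ) := by
  obtain ⟨g', hfg', hparts⟩ := hf.exists_integral_mul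
  -- The derivative supplied by `H¹₀` and the one that is differentiated again are introduced
  -- separately; uniqueness identifies them.
  obtain rfl : g' = g := hfg'.unique hfg
  have he' : ContDiff ℝ ∞ (deriv e) := (contDiff_infty_iff_deriv.1 he).2
  have h1 := hgh.integral_mul_deriv_of_abs_le he hC heC
  -- The function `deriv e` need not vanish at the endpoints: this is where the Dirichlet condition
  -- on `f` enters.
  have h2 := hparts (fun z => ((deriv e z : ℝ) : ℂ)) (Complex.ofRealCLM.contDiff.comp he')
  have h3 : ∀ z, deriv (fun z => ((deriv e z : ℝ) : ℂ)) z = ((deriv (deriv e) z : ℝ) : ℂ) :=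
    fun z => ((he'.differentiable (by simp)).differentiableAt.hasDerivAt.ofReal_comp).deriv
  simp_rw [h3] at h2
  rw [← neg_eq_iff_eq_neg.2 h1, h2, neg_neg]

/-! ### The Dirichlet eigenbasis. -/

/-- The `k`-th normalized Dirichlet eigenfunction `√2 sin((k + 1) π z)` on `(0,1)`. -/
noncomputable def dirichletSine (k : ℕ) (z : ℝ) : ℝ := √2 * Real.sin ((k + 1) * Real.pi * z)

/-- The `k`-th Dirichlet eigenvalue `((k + 1) π)²`. -/
noncomputable def dirichletEigenvalue (k : ℕ) : ℝ := (((k : ℝ) + 1) * Real.pi) ^ 2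

theorem contDiff_dirichletSine (k : ℕ) : ContDiff ℝ ∞ (dirichletSine k) := by
  unfold dirichletSine
  fun_prop

theorem deriv_deriv_dirichletSine (k : ℕ) (z : ℝ) :
    deriv (deriv (dirichletSine k)) z = - dirichletEigenvalue k * dirichletSine k z := by
  have hlin : ∀ z : ℝ, HasDerivAt (fun z : ℝ => ((k : ℝ) + 1) * Real.pi * z)
      (((k : ℝ) + 1) * Real.pi) z := fun z => by
    simpa using (hasDerivAt_id z).const_mul (((k : ℝ) + 1) * Real.pi)
  have h1 : deriv (dirichletSine k) = fun z =>
      √2 * (Real.cos ((k + 1) * Real.pi * z) * ((k + 1) * Real.pi)) := by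
    ext z
    exact ((hlin z).sin.const_mul _).deriv
  rw [h1, (((hlin z).cos.mul_const _).const_mul _).deriv, dirichletEigenvalue, dirichletSine]
  ring

/-- The sine vanishes at both ends, so it is at most `(k + 1) π` times the distance to the nearer
end, and that distance is at most `2 z (1 - z)`. -/
theorem abs_dirichletSine_le (k : ℕ) {z : ℝ} (hz : z ∈ Ioo (0 : ℝ) 1) :
    |dirichletSine k z| ≤ (√2 * ((k + 1) * Real.pi) * 2) * (z * (1 - z)) := by
  have hπ := Real.pi_pos
  have hk : (0 : ℝ) ≤ (k + 1) * Real.pi := by positivity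
  have h1 : |Real.sin ((k + 1) * Real.pi * z)| ≤ (k + 1) * Real.pi * z := by
    refine Real.abs_sin_le_abs.trans_eq (abs_of_nonneg (mul_nonneg hk hz.1.le))
  have h2 : |Real.sin ((k + 1) * Real.pi * z)| ≤ (k + 1) * Real.pi * (1 - z) := by
    have : Real.sin ((k + 1) * Real.pi * z)
        = Real.sin ((k + 1) * Real.pi * z - ((k + 1 : ℕ) : ℝ) * Real.pi) * (-1) ^ (k + 1) := by
      rw [Real.sin_sub_nat_mul_pi, mul_comm (_ ^ _), mul_assoc (Real.sin _),
        ← mul_pow]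
      simp
    rw [this, abs_mul, abs_pow, abs_neg, abs_one, one_pow, mul_one]
    refine Real.abs_sin_le_abs.trans_eq ?_
    rw [← abs_neg, abs_of_nonneg]
    · push_cast; ring
    · push_cast
      have := mul_nonneg hk (sub_nonneg.2 hz.2.le)
      linarith
  have h3 : |Real.sin ((k + 1) * Real.pi * z)| ≤ ((k + 1) * Real.pi) * (2 * (z * (1 - z))) := by
    rcases le_total z (1 / 2) with h | h
    · refine h1.trans ?_
      gcongr
      nlinarith [hz.1]
    · refine h2.trans ?_
      gcongr
      nlinarith [hz.2]
  rw [dirichletSine, abs_mul, abs_of_nonneg (Real.sqrt_nonneg 2)]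
  calc √2 * |Real.sin ((k + 1) * Real.pi * z)|
      ≤ √2 * (((k + 1) * Real.pi) * (2 * (z * (1 - z)))) := by gcongr
    _ = _ := by ring

theorem memLp_dirichletSine (k : ℕ) :
    MemLp (fun z => (dirichletSine k z : ℂ)) 2 (volume.restrict (Ioo (0 : ℝ) 1)) := by
  refine MemLp.of_bound (C := √2) ?_ (ae_of_all _ fun z => ?_)
  · exact (Complex.continuous_ofReal.comp (contDiff_dirichletSine k).continuous).aestronglyMeasurable
  · rw [Complex.norm_real, Real.norm_eq_abs, dirichletSine, abs_mul,
      abs_of_nonneg (Real.sqrt_nonneg 2)]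
    exact mul_le_of_le_one_right (Real.sqrt_nonneg 2) (Real.abs_sin_le_one _)

/-- The `k`-th normalized Dirichlet eigenfunction as an element of `L²((0,1); ℂ)`. -/
noncomputable def dirichletVector (k : ℕ) : StateSpace := (memLp_dirichletSine k).toLp

theorem inner_dirichletVector (k : ℕ) (f : StateSpace) :
    inner ℂ (dirichletVector k) f = ∫ z in Ioo (0 : ℝ) 1, f z * (dirichletSine k z : ℂ) := by
  rw [L2.inner_def]
  refine integral_congr_ae ?_
  filter_upwards [(memLp_dirichletSine k).coeFn_toLp] with z hz
  rw [dirichletVector, hz, RCLike.inner_apply, Complex.conj_ofReal]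

theorem integral_cos_int_mul_pi {m : ℤ} (hm : m ≠ 0) :
    ∫ z in (0 : ℝ)..1, Real.cos (m * Real.pi * z) = 0 := by
  have h : (m : ℝ) * Real.pi ≠ 0 := mul_ne_zero (by exact_mod_cast hm) Real.pi_ne_zero
  rw [intervalIntegral.integral_comp_mul_left (fun x => Real.cos x) h, integral_cos]
  simp [Real.sin_int_mul_pi]

theorem integral_dirichletSine_mul (j k : ℕ) :
    ∫ z in Ioo (0 : ℝ) 1, dirichletSine j z * dirichletSine k z = if j = k then 1 else 0 := by
  rw [← integral_Ioc_eq_integral_Ioo, ← intervalIntegral.integral_of_le zero_le_one]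
  have h : ∀ z : ℝ, dirichletSine j z * dirichletSine k z
      = Real.cos ((((j : ℤ) - k : ℤ) : ℝ) * Real.pi * z)
        - Real.cos ((((j : ℤ) + k + 2 : ℤ) : ℝ) * Real.pi * z) := fun z => by
    have e1 : (((j : ℤ) - k : ℤ) : ℝ) * Real.pi * z
        = (j + 1) * Real.pi * z - (k + 1) * Real.pi * z := by push_cast; ring
    have e2 : (((j : ℤ) + k + 2 : ℤ) : ℝ) * Real.pi * z
        = (j + 1) * Real.pi * z + (k + 1) * Real.pi * z := by push_cast; ring
    rw [e1, e2, Real.cos_sub, Real.cos_add, dirichletSine, dirichletSine]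
    have : √2 * √2 = (2 : ℝ) := Real.mul_self_sqrt (by norm_num)
    linear_combination Real.sin ((j + 1) * Real.pi * z) * Real.sin ((k + 1) * Real.pi * z) * this
  simp_rw [h]
  rw [intervalIntegral.integral_sub (Continuous.intervalIntegrable (by fun_prop) _ _)
    (Continuous.intervalIntegrable (by fun_prop) _ _),
    integral_cos_int_mul_pi (m := (j : ℤ) + k + 2) (by omega), sub_zero]
  split_ifs with hjk
  · simp [hjk]
  · exact integral_cos_int_mul_pi (by omega)

theorem orthonormal_dirichletVector : Orthonormal ℂ dirichletVector := by
  rw [orthonormal_iff_ite]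
  intro j k
  rw [inner_dirichletVector]
  have : ∫ z in Ioo (0 : ℝ) 1, dirichletVector k z * (dirichletSine j z : ℂ)
      = ∫ z in Ioo (0 : ℝ) 1, ((dirichletSine j z * dirichletSine k z : ℝ) : ℂ) := by
    refine integral_congr_ae ?_
    filter_upwards [(memLp_dirichletSine k).coeFn_toLp] with z hz
    rw [dirichletVector, hz, mul_comm, Complex.ofReal_mul]
  rw [this, integral_complex_ofReal, integral_dirichletSine_mul]
  split_ifs <;> simp

/-- The odd extension `F` of `f` to `(-1, 1)` has Fourier coefficients that are multiples of the
sine integrals of `f`, hence zero. Parseval gives `F = 0`, and `F = f` on `(0, 1)`. -/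
theorem eq_zero_of_inner_dirichletVector {f : StateSpace}
    (hf : ∀ k, inner ℂ (dirichletVector k) f = 0) : f = 0 := by
  set f₀ : ℝ → ℂ := (Ioo (0 : ℝ) 1).indicator f with hf₀
  have hm₀ : MemLp f₀ 2 volume := (memLp_indicator_iff_restrict measurableSet_Ioo).2 (Lp.memLp f)
  have hm₁ : MemLp (fun z => f₀ (-z)) 2 volume :=
    hm₀.comp_measurePreserving (Measure.measurePreserving_neg volume)
  set F : ℝ → ℂ := fun z => f₀ z - f₀ (-z) with hF
  have hmF : MemLp F 2 volume :=
    hm₀.sub hm₁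
  have hab : (-1 : ℝ) < 1 := by norm_num
  have hi₀ : IntervalIntegrable f₀ volume (-1) 1 := by
    rw [intervalIntegrable_iff_integrableOn_Ioc_of_le hab.le]
    exact (hm₀.restrict _).integrable (by norm_num)
  have hi₁ : IntervalIntegrable (fun z => f₀ (-z)) volume (-1) 1 := by
    rw [intervalIntegrable_iff_integrableOn_Ioc_of_le hab.le]
    exact (hm₁.restrict _).integrable (by norm_num)
  have hsin : ∀ n : ℤ, ∫ z in Ioo (0 : ℝ) 1, f z * (Real.sin (n * Real.pi * z) : ℂ) = 0 := by
    have hs : (√2 : ℂ) ≠ 0 := by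
      rw [Complex.ofReal_ne_zero]; positivity
    have hnat : ∀ k : ℕ, ∫ z in Ioo (0 : ℝ) 1,
        f z * (Real.sin (((k + 1 : ℕ) : ℝ) * Real.pi * z) : ℂ) = 0 := fun k => by
      have h := hf k
      rw [inner_dirichletVector] at h
      have : ∀ z : ℝ, f z * (dirichletSine k z : ℂ)
          = √2 * (f z * (Real.sin (((k + 1 : ℕ) : ℝ) * Real.pi * z) : ℂ)) := fun z => by
        rw [dirichletSine]; push_cast; ring
      simp_rw [this] at h
      rw [integral_const_mul] at h
      exact (mul_eq_zero.1 h).resolve_left hs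
    intro n
    obtain ⟨m, rfl | rfl⟩ := n.eq_nat_or_neg
    · rcases m with _ | k
      · simp
      · exact_mod_cast hnat k
    · rcases m with _ | k
      · simp
      · have := hnat k
        have e : ∀ z : ℝ, f z * (Real.sin (((-((k + 1 : ℕ) : ℤ) : ℤ) : ℝ) * Real.pi * z) : ℂ)
            = - (f z * (Real.sin (((k + 1 : ℕ) : ℝ) * Real.pi * z) : ℂ)) := fun z => by
          rw [← mul_neg, ← Complex.ofReal_neg, ← Real.sin_neg]
          congr 3
          push_cast; ring
        simp_rw [e]
        rw [integral_neg, this, neg_zero]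
  have hcoef : ∀ n : ℤ, fourierCoeffOn hab F n = 0 := by
    intro n
    rw [fourierCoeffOn_eq_integral]
    set χ : ℝ → ℂ := fun z => fourier (-n) (z : AddCircle ((1 : ℝ) - -1)) with hχ
    have hχc : Continuous χ := (map_continuous (fourier (-n))).comp (AddCircle.continuous_mk' _)
    have hχv : ∀ z, χ z - χ (-z) = -2 * Complex.I * (Real.sin (n * Real.pi * z) : ℂ) := by
      intro z
      have e1 : χ z = Complex.exp (-((n * Real.pi * z : ℝ) : ℂ) * Complex.I) := by
        simp only [hχ, fourier_coe_apply]
        congr 1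
        push_cast; ring
      have e2 : χ (-z) = Complex.exp (((n * Real.pi * z : ℝ) : ℂ) * Complex.I) := by
        simp only [hχ, fourier_coe_apply]
        congr 1
        push_cast; ring
      rw [e1, e2, Complex.ofReal_sin, Complex.sin]
      linear_combination (Complex.exp (-((n * Real.pi * z : ℝ) : ℂ) * Complex.I)
        - Complex.exp (((n * Real.pi * z : ℝ) : ℂ) * Complex.I)) * Complex.I_sq
    have i1 : IntervalIntegrable (fun z => χ z * f₀ z) volume (-1) 1 :=
      hi₀.continuousOn_mul hχc.continuousOn
    have i2 : IntervalIntegrable (fun z => χ (-z) * f₀ z) volume (-1) 1 :=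
      hi₀.continuousOn_mul (hχc.comp continuous_neg).continuousOn
    have i3 : IntervalIntegrable (fun z => χ z * f₀ (-z)) volume (-1) 1 :=
      hi₁.continuousOn_mul hχc.continuousOn
    -- Reflection moves the oddness of `F` onto the character, leaving `χ z - χ (-z)`, a multiple of
    -- the sine, against `f₀`.
    have e3 : ∫ z in (-1 : ℝ)..1, χ z * f₀ (-z) = ∫ z in (-1 : ℝ)..1, χ (-z) * f₀ z := by
      have := intervalIntegral.integral_comp_neg (a := (-1 : ℝ)) (b := 1)
        (fun z => χ (-z) * f₀ z)
      simpa using this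
    have e4 : ∫ z in (-1 : ℝ)..1, χ z • F z = 0 := by
      simp only [hF, smul_eq_mul, mul_sub]
      rw [intervalIntegral.integral_sub i1 i3, e3, ← intervalIntegral.integral_sub i1 i2]
      have e5 : ∀ z, χ z * f₀ z - χ (-z) * f₀ z
          = (Ioo (0 : ℝ) 1).indicator
            (fun z => -2 * Complex.I * (f z * (Real.sin (n * Real.pi * z) : ℂ))) z := fun z => by
        rw [← sub_mul, hχv, hf₀]
        by_cases hz : z ∈ Ioo (0 : ℝ) 1
        · rw [indicator_of_mem hz, indicator_of_mem hz]; ring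
        · rw [indicator_of_notMem hz, indicator_of_notMem hz, mul_zero]
      simp_rw [e5]
      rw [intervalIntegral.integral_of_le hab.le, setIntegral_indicator measurableSet_Ioo,
        inter_eq_self_of_subset_right (s := Ioc (-1 : ℝ) 1), integral_const_mul, hsin, mul_zero]
      intro z hz
      exact ⟨by linarith [hz.1], hz.2.le⟩
    rw [e4, smul_zero]
  have hsum := hasSum_sq_fourierCoeffOn hab (hmF.restrict (Ioc (-1) 1))
  simp_rw [hcoef] at hsum
  have hzero : ∫ z in (-1 : ℝ)..1, ‖F z‖ ^ 2 = 0 := by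
    have h := hsum.unique (a₂ := 0) (by simp)
    rw [smul_eq_mul] at h
    exact (mul_eq_zero.1 h).resolve_left (by norm_num)
  have hae : ∀ᵐ z ∂(volume.restrict (Ioc (-1 : ℝ) 1)), ‖F z‖ ^ 2 = 0 := by
    rw [intervalIntegral.integral_of_le hab.le] at hzero
    exact (integral_eq_zero_iff_of_nonneg (fun z => by positivity)
      ((memLp_two_iff_integrable_sq_norm (hmF.restrict _).1).1 (hmF.restrict _))).1 hzero
  refine Lp.ext ?_
  have hsub : Ioo (0 : ℝ) 1 ⊆ Ioc (-1) 1 := fun z hz => ⟨by linarith [hz.1], hz.2.le⟩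
  have hae' : ∀ᵐ z ∂(volume.restrict (Ioo (0 : ℝ) 1)), ‖F z‖ ^ 2 = 0 :=
    ae_restrict_of_ae_restrict_of_subset hsub hae
  filter_upwards [hae', ae_restrict_mem measurableSet_Ioo,
    Lp.coeFn_zero ℂ 2 (volume.restrict (Ioo (0 : ℝ) 1))] with z hz hmem h0
  have h1 : F z = 0 := by simpa using hz
  have h2 : -z ∉ Ioo (0 : ℝ) 1 := fun h => by linarith [h.1, hmem.1]
  simp only [hF, hf₀, indicator_of_mem hmem, indicator_of_notMem h2, sub_zero] at h1
  rw [h1, h0, Pi.zero_apply]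

/-- The Hilbert basis of Dirichlet eigenfunctions of `L²((0,1); ℂ)`. -/
noncomputable def dirichletBasis : HilbertBasis ℕ ℂ StateSpace :=
  HilbertBasis.mkOfOrthogonalEqBot orthonormal_dirichletVector (by
    rw [Submodule.eq_bot_iff]
    intro f hf
    exact eq_zero_of_inner_dirichletVector fun k =>
      (Submodule.mem_orthogonal _ _).1 hf _ (Submodule.subset_span (mem_range_self k)))

theorem dirichletBasis_apply (k : ℕ) : dirichletBasis k = dirichletVector k :=
  congrFun (HilbertBasis.coe_mkOfOrthogonalEqBot _ _) k

/-- In the Dirichlet basis the free generator is multiplication by `-i` times the eigenvalue. -/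
theorem FreeGenerator.inner_dirichletBasis {f y : StateSpace} (h : FreeGenerator f y) (k : ℕ) :
    inner ℂ (dirichletBasis k) y
      = -(Complex.I * dirichletEigenvalue k) * inner ℂ (dirichletBasis k) f := by
  obtain ⟨hf, g, w, hfg, hgw, rfl⟩ := h
  rw [inner_smul_right, dirichletBasis_apply, inner_dirichletVector, inner_dirichletVector,
    hf.integral_second_weakDeriv_mul hfg hgw (contDiff_dirichletSine k) (by positivity)
      fun z hz => abs_dirichletSine_le k hz]
  have : ∀ z : ℝ, f z * ((deriv (deriv (dirichletSine k)) z : ℝ) : ℂ)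
      = -(dirichletEigenvalue k : ℂ) * (f z * (dirichletSine k z : ℂ)) := fun z => by
    rw [deriv_deriv_dirichletSine]; push_cast; ring
  simp_rw [this]
  rw [integral_const_mul]
  ring

/-! ### Unitary operators diagonal in a Hilbert basis. -/

section PhaseMap

variable {ι E : Type*} [NormedAddCommGroup E] [InnerProductSpace ℂ E]

theorem HilbertBasis.ext_inner_left (b : HilbertBasis ι ℂ E) {x y : E}
    (h : ∀ k, inner ℂ (b k) x = inner ℂ (b k) y) : x = y := by
  refine b.repr.injective (lp.ext (funext fun k => ?_))
  rw [b.repr_apply_apply, b.repr_apply_apply, h]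

variable [CompleteSpace E]

/-- The Hilbert basis obtained by multiplying each basis vector by a phase. -/
noncomputable def HilbertBasis.phase (b : HilbertBasis ι ℂ E) (θ : ι → ℝ) : HilbertBasis ι ℂ E :=
  HilbertBasis.mkOfOrthogonalEqBot (v := fun k => Complex.exp (θ k * Complex.I) • b k)
    (by
      classical
      have hb := orthonormal_iff_ite.1 b.orthonormal
      rw [orthonormal_iff_ite]
      intro i j
      rw [inner_smul_left, inner_smul_right, hb]
      split_ifs with hij
      · rw [hij, mul_one, Complex.conj_mul', Complex.norm_exp_ofReal_mul_I]
        simp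
      · simp)
    (by
      rw [Submodule.eq_bot_iff]
      intro x hx
      refine b.ext_inner_left fun k => ?_
      have := (Submodule.mem_orthogonal _ _).1 hx _ (Submodule.subset_span (mem_range_self k))
      rw [inner_smul_left, mul_eq_zero, map_eq_zero] at this
      rw [inner_zero_right]
      exact this.resolve_left (Complex.exp_ne_zero _))

theorem HilbertBasis.phase_apply (b : HilbertBasis ι ℂ E) (θ : ι → ℝ) (k : ι) :
    b.phase θ k = Complex.exp (θ k * Complex.I) • b k :=
  congrFun (HilbertBasis.coe_mkOfOrthogonalEqBot _ _) k

/-- The unitary operator that is diagonal in a Hilbert basis, with eigenvalues `exp (i θ k)`. -/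
noncomputable def HilbertBasis.phaseMap (b : HilbertBasis ι ℂ E) (θ : ι → ℝ) : E ≃ₗᵢ[ℂ] E :=
  b.repr.trans (b.phase θ).repr.symm

theorem HilbertBasis.inner_phaseMap (b : HilbertBasis ι ℂ E) (θ : ι → ℝ) (k : ι) (x : E) :
    inner ℂ (b k) (b.phaseMap θ x) = Complex.exp (θ k * Complex.I) * inner ℂ (b k) x := by
  have h1 : inner ℂ (b.phase θ k) (b.phaseMap θ x) = inner ℂ (b k) x := by
    rw [← HilbertBasis.repr_apply_apply, ← HilbertBasis.repr_apply_apply]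
    simp [HilbertBasis.phaseMap]
  rw [b.phase_apply, inner_smul_left] at h1
  rw [← h1, ← mul_assoc, Complex.mul_conj', Complex.norm_exp_ofReal_mul_I]
  simp

theorem HilbertBasis.phaseMap_neg_phaseMap (b : HilbertBasis ι ℂ E) (θ : ι → ℝ) (x : E) :
    b.phaseMap (-θ) (b.phaseMap θ x) = x := by
  refine b.ext_inner_left fun k => ?_
  rw [b.inner_phaseMap, b.inner_phaseMap, ← mul_assoc, ← Complex.exp_add]
  simp

theorem HilbertBasis.phaseMap_self (b : HilbertBasis ι ℂ E) (θ : ι → ℝ) (k : ι) :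
    b.phaseMap θ (b k) = Complex.exp (θ k * Complex.I) • b k := by
  classical
  have hb := orthonormal_iff_ite.1 b.orthonormal
  refine b.ext_inner_left fun j => ?_
  rw [b.inner_phaseMap, inner_smul_right, hb]
  split_ifs with hjk
  · rw [hjk]
  · simp

-- Orbits of basis vectors are continuous, hence so are those of their span. As every operator is an
-- isometry, approximating `x` from the span approximates its orbit uniformly in `t`.
open Filter Topology in
theorem HilbertBasis.continuous_phaseMap (b : HilbertBasis ι ℂ E) (ν : ι → ℝ) (x : E) :
    Continuous fun t : ℝ => b.phaseMap (fun k => ν k * t) x := by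
  have hspan : ∀ y ∈ Submodule.span ℂ (range b),
      Continuous fun t : ℝ => b.phaseMap (fun k => ν k * t) y := by
    intro y hy
    induction hy using Submodule.span_induction with
    | mem y hy =>
      obtain ⟨k, rfl⟩ := hy
      simp_rw [b.phaseMap_self]
      fun_prop
    | zero => simpa using continuous_const
    | add y z _ _ hy hz => simpa only [map_add] using! hy.add hz
    | smul a y _ hy => simpa only [map_smul] using! hy.const_smul a
  have hx : x ∈ closure (Submodule.span ℂ (range b) : Set E) := by
    rw [← Submodule.topologicalClosure_coe, b.dense_span]
    trivial
  refine continuous_of_uniform_approx_of_continuous fun u hu => ?_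
  obtain ⟨ε, hε, hεu⟩ := Metric.mem_uniformity_dist.1 hu
  obtain ⟨y, hy, hxy⟩ := Metric.mem_closure_iff.1 hx ε hε
  refine ⟨_, hspan y hy, fun t => hεu ?_⟩
  rwa [LinearIsometryEquiv.dist_map]

-- Operator and vector both vary with `t`: the increment `y t - y t₀` is controlled by isometry, the
-- fixed vector `y t₀` by strong continuity.
open Filter Topology in
theorem HilbertBasis.continuousOn_phaseMap (b : HilbertBasis ι ℂ E) (ν : ι → ℝ) {y : ℝ → E}
    {s : Set ℝ} (hy : ContinuousOn y s) :
    ContinuousOn (fun t : ℝ => b.phaseMap (fun k => ν k * t) (y t)) s := by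
  intro t₀ ht₀
  have h1 : Tendsto (fun t => b.phaseMap (fun k => ν k * t) (y t₀)) (𝓝[s] t₀)
      (𝓝 (b.phaseMap (fun k => ν k * t₀) (y t₀))) :=
    (b.continuous_phaseMap ν (y t₀)).continuousAt.tendsto.mono_left nhdsWithin_le_nhds
  have h2 : Tendsto (fun t => b.phaseMap (fun k => ν k * t) (y t - y t₀)) (𝓝[s] t₀) (𝓝 0) := by
    rw [tendsto_zero_iff_norm_tendsto_zero]
    simp_rw [LinearIsometryEquiv.norm_map]
    rw [← tendsto_zero_iff_norm_tendsto_zero]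
    exact tendsto_sub_nhds_zero_iff.2 (hy t₀ ht₀)
  have h3 := h2.add h1
  rw [zero_add] at h3
  refine h3.congr fun t => ?_
  rw [← map_add, sub_add_cancel]

end PhaseMap

/-! ### Scalar variation of constants with integrable forcing. -/

theorem AbsolutelyContinuousOnInterval.complex_ofReal {f : ℝ → ℝ} {a b : ℝ}
    (hf : AbsolutelyContinuousOnInterval f a b) :
    AbsolutelyContinuousOnInterval (fun x => (f x : ℂ)) a b := by
  simpa only [AbsolutelyContinuousOnInterval, Complex.isometry_ofReal.dist_eq] using hf

theorem IntervalIntegrable.absolutelyContinuousOnInterval_integral_complex {v : ℝ → ℂ} {a b c : ℝ}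
    (hv : IntervalIntegrable v volume a b) (hc : c ∈ uIcc a b) :
    AbsolutelyContinuousOnInterval (fun x => ∫ s in c..x, v s) a b := by
  have hre : IntervalIntegrable (fun s => (v s).re) volume a b := ⟨hv.1.re, hv.2.re⟩
  have him : IntervalIntegrable (fun s => (v s).im) volume a b := ⟨hv.1.im, hv.2.im⟩
  have h := (hre.absolutelyContinuousOnInterval_intervalIntegral hc).complex_ofReal.add
    ((him.absolutelyContinuousOnInterval_intervalIntegral hc).complex_ofReal.const_smul Complex.I)
  have key : ∀ x ∈ uIcc a b, ((((∫ s in c..x, (v s).re : ℝ)) : ℂ)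
      + Complex.I • (((∫ s in c..x, (v s).im : ℝ)) : ℂ)) = ∫ s in c..x, v s := by
    intro x hx
    have hvx : IntervalIntegrable v volume c x := hv.mono_set (uIcc_subset_uIcc hc hx)
    have e1 : ∫ s in c..x, (v s).re = (∫ s in c..x, v s).re :=
      (Complex.reCLM.intervalIntegral_comp_comm hvx)
    have e2 : ∫ s in c..x, (v s).im = (∫ s in c..x, v s).im :=
      (Complex.imCLM.intervalIntegral_comp_comm hvx)
    rw [e1, e2, smul_eq_mul, mul_comm, Complex.re_add_im]
  -- The identity `key` is available only on `uIcc a b`, so absolute continuity is transferred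
  -- through its definition, which evaluates the function only there.
  rw [absolutelyContinuousOnInterval_iff] at h ⊢
  intro ε hε
  obtain ⟨δ, hδ, H⟩ := h ε hε
  refine ⟨δ, hδ, fun E hE hEδ => ?_⟩
  refine (Finset.sum_congr rfl fun i hi => ?_).trans_lt (H E hE hEδ)
  simp only [Pi.add_apply]
  rw [key _ (hE.1 i hi).1, key _ (hE.1 i hi).2]

/-- The variation of constants formula for a scalar linear equation with integrable forcing. -/
theorem exp_mul_eq_add_integral_of_eq_integral {T ν : ℝ} (hT : 0 ≤ T) {c₀ : ℂ} {c v : ℝ → ℂ}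
    (hc : ContinuousOn c (Icc 0 T)) (hv : IntervalIntegrable v volume 0 T)
    (h : ∀ t ∈ Icc 0 T, c t = c₀ + -(Complex.I * ν) * (∫ s in (0 : ℝ)..t, c s)
      + ∫ s in (0 : ℝ)..t, v s) {t : ℝ} (ht : t ∈ Icc 0 T) :
    Complex.exp ((ν * t : ℝ) * Complex.I) * c t
      = c₀ + ∫ s in (0 : ℝ)..t, Complex.exp ((ν * s : ℝ) * Complex.I) * v s := by
  have hu : uIcc 0 T = Icc 0 T := uIcc_of_le hT
  have h0 : (0 : ℝ) ∈ uIcc 0 T := left_mem_uIcc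
  have hci : IntervalIntegrable c volume 0 T := (hu ▸ hc).intervalIntegrable
  set e : ℝ → ℂ := fun s => Complex.exp ((ν * s : ℝ) * Complex.I) with he
  have hed : ∀ s, HasDerivAt e (e s * (ν * Complex.I)) s := fun s => by
    have h1 : HasDerivAt (fun s : ℝ => ν * s) ν s := by
      simpa using (hasDerivAt_id s).const_mul ν
    exact (h1.ofReal_comp.mul_const Complex.I).cexp
  have hec : ContDiff ℝ 1 e := by
    have : ContDiff ℝ 1 fun s : ℝ => ((ν * s : ℝ) : ℂ) * Complex.I :=
      (Complex.ofRealCLM.contDiff.comp (contDiff_const.mul contDiff_id)).mul contDiff_const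
    exact this.cexp
  have hev : IntervalIntegrable (fun s => e s * v s) volume 0 T :=
    hv.continuousOn_mul hec.continuous.continuousOn
  -- `C` is the right-hand side of the equation: it equals `c` on `[0, T]` and is visibly absolutely
  -- continuous.
  set C : ℝ → ℂ := fun t => c₀ + -(Complex.I * ν) * (∫ s in (0 : ℝ)..t, c s)
    + ∫ s in (0 : ℝ)..t, v s with hC
  have hCac : AbsolutelyContinuousOnInterval C 0 T :=
    ((contDiffOn_const (c := c₀)).absolutelyContinuousOnInterval.fun_add
      ((hci.absolutelyContinuousOnInterval_integral_complex h0).const_smul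
        (-(Complex.I * (ν : ℂ))))).fun_add
      (hv.absolutelyContinuousOnInterval_integral_complex h0)
  have hG : AbsolutelyContinuousOnInterval
      (fun t => e t • C t - ∫ s in (0 : ℝ)..t, e s * v s) 0 T :=
    ((hec.contDiffOn).absolutelyContinuousOnInterval.fun_smul hCac).fun_sub
      (hev.absolutelyContinuousOnInterval_integral_complex h0)
  -- Almost everywhere the derivative of `e` cancels the term `-iνc` in the derivative of `C`, and
  -- what is left is `e v - e v`. Since `v` is merely integrable, absolute continuity is what makes
  -- the function constant.
  obtain ⟨K, hK⟩ := hG.const_of_ae_hasDerivAt_zero (by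
    filter_upwards [hci.ae_hasDerivAt_integral, hv.ae_hasDerivAt_integral,
      hev.ae_hasDerivAt_integral] with x h1 h2 h3 hx
    have d := ((hed x).smul ((((h1 hx 0 h0).const_mul (-(Complex.I * (ν : ℂ)))).const_add
      c₀).add (h2 hx 0 h0))).sub (h3 hx 0 h0)
    have hcx := h x (hu ▸ hx)
    convert! d using 1
    simp only [smul_eq_mul, Pi.add_apply]
    rw [← hcx]
    ring)
  have hK0 := hK 0 h0
  have hKt := hK t (hu ▸ ht)
  rw [← hK0] at hKt
  have hCt : C t = c t := (h t ht).symm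
  rw [hCt] at hKt
  simp only [he, hC, smul_eq_mul, intervalIntegral.integral_same, mul_zero, add_zero, sub_zero,
    Complex.ofReal_zero, zero_mul, Complex.exp_zero, one_mul] at hKt
  rw [← hKt]
  ring

/-! ### The free group and the control operator. -/

/-- The free Schrödinger group, generated by `A f = i f''` with Dirichlet boundary conditions. -/
noncomputable def freeGroup (t : ℝ) : StateSpace ≃ₗᵢ[ℂ] StateSpace :=
  dirichletBasis.phaseMap fun k => -dirichletEigenvalue k * t

theorem freeGroup_freeGroup_neg (t : ℝ) (x : StateSpace) : freeGroup t (freeGroup (-t) x) = x := by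
  have h := dirichletBasis.phaseMap_neg_phaseMap (fun k => -dirichletEigenvalue k * -t) x
  simpa only [freeGroup, Pi.neg_def, mul_neg, neg_neg] using h

theorem freeGroup_neg_freeGroup (t : ℝ) (x : StateSpace) : freeGroup (-t) (freeGroup t x) = x := by
  simpa using freeGroup_freeGroup_neg (-t) x

theorem continuous_freeGroup (x : StateSpace) : Continuous fun t => freeGroup t x :=
  dirichletBasis.continuous_phaseMap _ x

theorem continuousOn_freeGroup_neg {y : ℝ → StateSpace} {s : Set ℝ} (hy : ContinuousOn y s) :
    ContinuousOn (fun t => freeGroup (-t) (y t)) s := by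
  simpa only [freeGroup, neg_mul_neg] using dirichletBasis.continuousOn_phaseMap dirichletEigenvalue hy

theorem inner_freeGroup_neg (t : ℝ) (k : ℕ) (x : StateSpace) :
    inner ℂ (dirichletBasis k) (freeGroup (-t) x)
      = Complex.exp ((dirichletEigenvalue k * t : ℝ) * Complex.I)
        * inner ℂ (dirichletBasis k) x := by
  rw [freeGroup, HilbertBasis.inner_phaseMap, neg_mul_neg]

theorem norm_controlOp_le (μ : PotentialSpace) (f : StateSpace) :
    ‖controlOp μ f‖ ≤ ‖μ‖ * ‖f‖ := by
  rw [controlOp, norm_smul, Complex.norm_I, one_mul]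
  exact Lp.norm_smul_le μ f

theorem controlOp_sub (μ : PotentialSpace) (f g : StateSpace) :
    controlOp μ (f - g) = controlOp μ f - controlOp μ g := by
  rw [controlOp, controlOp, controlOp, ← smul_sub, sub_eq_add_neg, Lp.add_smul, Lp.smul_neg,
    ← sub_eq_add_neg]

theorem continuous_controlOp (μ : PotentialSpace) : Continuous (controlOp μ) := by
  refine (LipschitzWith.of_dist_le_mul (K := ‖μ‖₊) fun f g => ?_).continuous
  rw [dist_eq_norm, dist_eq_norm, ← controlOp_sub]
  exact norm_controlOp_le μ _

/-! ### Estimates for mild solutions and the first-order expansion. -/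

section Control

variable {T : ℝ}

theorem ControlSpace.integrableOn (u : ControlSpace T) : IntegrableOn u (Ioo 0 T) :=
  (Lp.memLp u).integrable (by norm_num)

theorem ControlSpace.intervalIntegrable (hT : 0 ≤ T) (u : ControlSpace T) :
    IntervalIntegrable u volume 0 T := by
  rw [intervalIntegrable_iff_integrableOn_Ioo_of_le hT]
  exact u.integrableOn

/-- Cauchy–Schwarz on an interval of length `T`; every factor `√T` in the estimates originates here.
-/
theorem ControlSpace.integral_norm_le (hT : 0 ≤ T) (u : ControlSpace T) :
    ∫ s in Ioo 0 T, ‖u s‖ ≤ √T * ‖u‖ := by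
  have h := eLpNorm_le_eLpNorm_mul_rpow_measure_univ (p := 1) (q := 2) (by norm_num)
    (Lp.aestronglyMeasurable u)
  rw [integral_norm_eq_lintegral_enorm (Lp.aestronglyMeasurable u), ← eLpNorm_one_eq_lintegral_enorm,
    Lp.norm_def, mul_comm]
  refine (ENNReal.toReal_mono ?_ h).trans_eq ?_
  · refine ENNReal.mul_ne_top (Lp.eLpNorm_ne_top u) ?_
    exact ENNReal.rpow_ne_top_of_nonneg (by norm_num) (measure_ne_top _ _)
  · rw [ENNReal.toReal_mul, ← ENNReal.toReal_rpow, Real.sqrt_eq_rpow]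
    congr 2
    · simp [hT]
    · norm_num

theorem ControlSpace.intervalIntegrable_smul {E : Type*} [NormedAddCommGroup E] [NormedSpace ℝ E]
    (hT : 0 ≤ T) (u : ControlSpace T) {f : ℝ → E} (hf : ContinuousOn f (Icc 0 T)) :
    IntervalIntegrable (fun s => u s • f s) volume 0 T :=
  (u.intervalIntegrable hT).smul_continuousOn (by rwa [uIcc_of_le hT])

theorem ControlSpace.norm_integral_smul_le {E : Type*} [NormedAddCommGroup E] [NormedSpace ℝ E]
    (hT : 0 ≤ T) (u : ControlSpace T) {f : ℝ → E} {X : ℝ} (hX : 0 ≤ X)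
    (hf : ∀ s ∈ Icc 0 T, ‖f s‖ ≤ X) {t : ℝ} (ht : t ∈ Icc 0 T) :
    ‖∫ s in (0 : ℝ)..t, u s • f s‖ ≤ √T * ‖u‖ * X := by
  have hsub : Ioo 0 t ⊆ Ioo 0 T := Ioo_subset_Ioo_right ht.2
  have hint : IntegrableOn (fun s => ‖u s‖ * X) (Ioo 0 T) := u.integrableOn.norm.mul_const X
  rw [intervalIntegral.integral_of_le ht.1, integral_Ioc_eq_integral_Ioo]
  calc ‖∫ s in Ioo 0 t, u s • f s‖ ≤ ∫ s in Ioo 0 t, ‖u s‖ * X := by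
        refine norm_integral_le_of_norm_le (hint.mono_set hsub) ?_
        filter_upwards [ae_restrict_mem measurableSet_Ioo] with s hs
        rw [norm_smul]
        gcongr
        exact hf s (Ioo_subset_Icc_self (hsub hs))
    _ ≤ ∫ s in Ioo 0 T, ‖u s‖ * X :=
        setIntegral_mono_set hint (ae_of_all _ fun s => by positivity) hsub.eventuallyLE
    _ = (∫ s in Ioo 0 T, ‖u s‖) * X := integral_mul_const _ _
    _ ≤ √T * ‖u‖ * X := by gcongr; exact u.integral_norm_le hT

/-- Mild solutions satisfy the variation of constants formula, here in the interaction picture. -/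
theorem IsMildSolution.freeGroup_neg_apply {μ : PotentialSpace} {u : ControlSpace T}
    {φ₀ : StateSpace} {φ : ℝ → StateSpace} (hT : 0 ≤ T) (h : IsMildSolution μ T u φ₀ φ)
    {t : ℝ} (ht : t ∈ Icc 0 T) :
    freeGroup (-t) (φ t)
      = φ₀ + ∫ s in (0 : ℝ)..t, u s • freeGroup (-s) (controlOp μ (φ s)) := by
  obtain ⟨hφ, hmild⟩ := h
  have hB : ContinuousOn (fun s => controlOp μ (φ s)) (Icc 0 T) :=
    (continuous_controlOp μ).comp_continuousOn hφ
  have hφi : IntervalIntegrable φ volume 0 T := ((uIcc_of_le hT).symm ▸ hφ).intervalIntegrable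
  have hBi := u.intervalIntegrable_smul hT hB
  have hSi := u.intervalIntegrable_smul hT (continuousOn_freeGroup_neg hB)
  have hsub : ∀ {t}, t ∈ Icc 0 T → uIcc 0 t ⊆ uIcc 0 T := fun {t} ht =>
    uIcc_subset_uIcc left_mem_uIcc (by rwa [uIcc_of_le hT])
  refine dirichletBasis.ext_inner_left fun k => ?_
  set ℓ : StateSpace →L[ℂ] ℂ := innerSL ℂ (dirichletBasis k)
  have hℓa : ∀ x, inner ℂ (dirichletBasis k) x = ℓ x := fun x => rfl
  have hcomm : ∀ {f : ℝ → StateSpace}, IntervalIntegrable f volume 0 T → ∀ {t}, t ∈ Icc 0 T →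
      ℓ (∫ s in (0 : ℝ)..t, f s) = ∫ s in (0 : ℝ)..t, ℓ (f s) := fun {f} hf {t} ht =>
    (ℓ.intervalIntegral_comp_comm (hf.mono_set (hsub ht))).symm
  -- In the `k`-th coordinate the unbounded operator is multiplication by `-i` times the eigenvalue,
  -- so the mild equation becomes a scalar integral equation.
  have key := exp_mul_eq_add_integral_of_eq_integral (ν := dirichletEigenvalue k) (c₀ := ℓ φ₀)
    (c := fun s => ℓ (φ s)) (v := fun s => ℓ (u s • controlOp μ (φ s))) hT
    (ℓ.continuous.comp_continuousOn hφ) ⟨ℓ.integrable_comp hBi.1, ℓ.integrable_comp hBi.2⟩ (fun t ht => by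
      obtain ⟨y, hy, hty⟩ := hmild t ht
      have e1 := hy.inner_dirichletBasis k
      rw [hℓa, hℓa, hcomm hφi ht] at e1
      simp only [hty, map_add, e1, hcomm hBi ht]) ht
  rw [inner_freeGroup_neg, hℓa, key, inner_add_right, hℓa, hℓa, hcomm hSi ht]
  congr 1
  refine intervalIntegral.integral_congr fun s _ => ?_
  have e2 : ∀ x : StateSpace, ℓ (u s • x) = (u s : ℂ) * ℓ x := fun x =>
    ((ℓ.restrictScalars ℝ).map_smul (u s) x).trans (Complex.real_smul)
  simp only [e2]
  rw [← hℓa (freeGroup _ _), inner_freeGroup_neg, hℓa]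
  ring

/-- At a maximum point `t₀` of the norm, the variation of constants formula bounds the maximum by
`‖φ₀‖` plus `‖μ‖ √T r` times itself. The factor is less than `1`, so the term is absorbed. -/
theorem IsMildSolution.norm_le {μ : PotentialSpace} {u : ControlSpace T}
    {φ₀ : StateSpace} {φ : ℝ → StateSpace} (hT : 0 ≤ T) (h : IsMildSolution μ T u φ₀ φ)
    {r : ℝ} (hu : ‖u‖ ≤ r) (hr : ‖μ‖ * √T * r < 1) {t : ℝ} (ht : t ∈ Icc 0 T) :
    ‖φ t‖ ≤ ‖φ₀‖ / (1 - ‖μ‖ * √T * r) := by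
  obtain ⟨t₀, ht₀, hmax⟩ := isCompact_Icc.exists_isMaxOn (nonempty_Icc.2 hT) h.1.norm
  have hle : ∀ s ∈ Icc 0 T, ‖φ s‖ ≤ ‖φ t₀‖ := fun s hs => hmax hs
  refine (hle t ht).trans ?_
  have hB : ∀ s ∈ Icc 0 T, ‖freeGroup (-s) (controlOp μ (φ s))‖ ≤ ‖μ‖ * ‖φ t₀‖ := fun s hs => by
    rw [LinearIsometryEquiv.norm_map]
    exact (norm_controlOp_le μ _).trans (by gcongr; exact hle s hs)
  have h1 : ‖φ t₀‖ ≤ ‖φ₀‖ + √T * ‖u‖ * (‖μ‖ * ‖φ t₀‖) := by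
    calc ‖φ t₀‖ = ‖freeGroup (-t₀) (φ t₀)‖ := ((freeGroup (-t₀)).norm_map _).symm
      _ ≤ _ := by
        rw [h.freeGroup_neg_apply hT ht₀]
        exact (norm_add_le _ _).trans (by
          gcongr
          exact u.norm_integral_smul_le hT (by positivity) hB ht₀)
  have h2 : √T * ‖u‖ * (‖μ‖ * ‖φ t₀‖) ≤ √T * r * (‖μ‖ * ‖φ t₀‖) := by gcongr
  rw [le_div_iff₀ (by linarith)]
  linarith

/-- The kernel of the first-order expansion of the end-point map in the control. -/
noncomputable def firstOrderKernel (μ : PotentialSpace) (φ₀ : StateSpace) (s : ℝ) : StateSpace :=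
  freeGroup (-s) (controlOp μ (freeGroup s φ₀))

theorem continuous_firstOrderKernel (μ : PotentialSpace) (φ₀ : StateSpace) :
    Continuous (firstOrderKernel μ φ₀) := by
  rw [← continuousOn_univ]
  exact continuousOn_freeGroup_neg
    ((continuous_controlOp μ).comp (continuous_freeGroup φ₀)).continuousOn

theorem norm_firstOrderKernel_le (μ : PotentialSpace) (φ₀ : StateSpace) (s : ℝ) :
    ‖firstOrderKernel μ φ₀ s‖ ≤ ‖μ‖ * ‖φ₀‖ := by
  rw [firstOrderKernel, LinearIsometryEquiv.norm_map]
  simpa using norm_controlOp_le μ (freeGroup s φ₀)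

theorem ControlSpace.integrable_smul_firstOrderKernel (u : ControlSpace T) (μ : PotentialSpace)
    (φ₀ : StateSpace) :
    Integrable (fun s => u s • firstOrderKernel μ φ₀ s) (volume.restrict (Ioo 0 T)) :=
  Integrable.smul_bdd (C := ‖μ‖ * ‖φ₀‖) u.integrableOn
    (continuous_firstOrderKernel μ φ₀).aestronglyMeasurable
    (ae_of_all _ (norm_firstOrderKernel_le μ φ₀))

/-- The first-order term, linear in the control, of the end-point map in the interaction
picture. -/
noncomputable def firstOrderMap (T : ℝ) (μ : PotentialSpace) (φ₀ : StateSpace) :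
    ControlSpace T →ₗ[ℝ] StateSpace where
  toFun u := ∫ s in Ioo 0 T, u s • firstOrderKernel μ φ₀ s
  map_add' u v := by
    rw [← integral_add (u.integrable_smul_firstOrderKernel μ φ₀)
      (v.integrable_smul_firstOrderKernel μ φ₀)]
    refine integral_congr_ae ?_
    filter_upwards [Lp.coeFn_add u v] with s hs
    rw [hs, Pi.add_apply, add_smul]
  map_smul' a u := by
    rw [RingHom.id_apply, ← integral_smul]
    refine integral_congr_ae ?_
    filter_upwards [Lp.coeFn_smul a u] with s hs
    rw [hs, Pi.smul_apply, smul_eq_mul, mul_smul]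

theorem firstOrderMap_apply (hT : 0 ≤ T) (μ : PotentialSpace) (φ₀ : StateSpace)
    (u : ControlSpace T) :
    firstOrderMap T μ φ₀ u = ∫ s in (0 : ℝ)..T, u s • firstOrderKernel μ φ₀ s := by
  rw [intervalIntegral.integral_of_le hT, integral_Ioc_eq_integral_Ioo]
  rfl

theorem norm_firstOrderMap_le (hT : 0 ≤ T) (μ : PotentialSpace) (φ₀ : StateSpace)
    (u : ControlSpace T) : ‖firstOrderMap T μ φ₀ u‖ ≤ ‖μ‖ * ‖φ₀‖ * √T * ‖u‖ := by
  rw [firstOrderMap_apply hT]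
  refine (u.norm_integral_smul_le hT (by positivity)
    (fun s _ => norm_firstOrderKernel_le μ φ₀ s) ⟨hT, le_rfl⟩).trans_eq ?_
  ring

/-- The variation of constants formula is used twice: once for the deviation from the free evolution
(`hdev`), and once at time `T`, where the remainder is the same integral applied to that deviation.
Each use contributes `‖μ‖ √T r`, and `M` bounds the solution. -/
theorem IsMildSolution.norm_sub_firstOrder_le {μ : PotentialSpace} {u : ControlSpace T}
    {φ₀ : StateSpace} {φ : ℝ → StateSpace} (hT : 0 ≤ T) (h : IsMildSolution μ T u φ₀ φ)
    {r : ℝ} (hu : ‖u‖ ≤ r) (hr : ‖μ‖ * √T * r < 1) :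
    ‖φ T - (freeGroup T φ₀ + freeGroup T (firstOrderMap T μ φ₀ u))‖
      ≤ ‖μ‖ ^ 2 * ‖φ₀‖ * T * r ^ 2 / (1 - ‖μ‖ * √T * r) := by
  have hr0 : 0 ≤ r := (norm_nonneg u).trans hu
  set M := ‖φ₀‖ / (1 - ‖μ‖ * √T * r) with hM
  have hM0 : 0 ≤ M := div_nonneg (norm_nonneg _) (by linarith)
  have hB : ContinuousOn (fun s => controlOp μ (φ s)) (Icc 0 T) :=
    (continuous_controlOp μ).comp_continuousOn h.1
  have hTT : T ∈ Icc 0 T := ⟨hT, le_rfl⟩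
  have hdev : ∀ s ∈ Icc 0 T, ‖φ s - freeGroup s φ₀‖ ≤ √T * r * (‖μ‖ * M) := fun s hs => by
    rw [← (freeGroup (-s)).norm_map, map_sub, freeGroup_neg_freeGroup,
      h.freeGroup_neg_apply hT hs, add_sub_cancel_left]
    refine (u.norm_integral_smul_le hT (X := ‖μ‖ * M) (by positivity) (fun s hs => ?_) hs).trans
      (by gcongr)
    rw [LinearIsometryEquiv.norm_map]
    exact (norm_controlOp_le μ _).trans (by gcongr; exact h.norm_le hT hu hr hs)
  have e1 : φ T - (freeGroup T φ₀ + freeGroup T (firstOrderMap T μ φ₀ u))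
      = freeGroup T (∫ s in (0 : ℝ)..T,
        u s • freeGroup (-s) (controlOp μ (φ s - freeGroup s φ₀))) := by
    have e2 : φ T = freeGroup T (freeGroup (-T) (φ T)) := (freeGroup_freeGroup_neg T _).symm
    rw [e2, h.freeGroup_neg_apply hT hTT, ← map_add, ← map_sub, add_sub_add_left_eq_sub,
      firstOrderMap_apply hT, ← intervalIntegral.integral_sub
        (u.intervalIntegrable_smul hT (continuousOn_freeGroup_neg hB))
        (u.intervalIntegrable_smul hT (continuous_firstOrderKernel μ φ₀).continuousOn)]
    simp_rw [← smul_sub, firstOrderKernel, ← map_sub, ← controlOp_sub]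
  rw [e1, LinearIsometryEquiv.norm_map]
  refine (u.norm_integral_smul_le hT (X := ‖μ‖ * (√T * r * (‖μ‖ * M))) (by positivity)
    (fun s hs => ?_) hTT).trans ?_
  · rw [LinearIsometryEquiv.norm_map]
    exact (norm_controlOp_le μ _).trans (by gcongr; exact hdev s hs)
  · calc √T * ‖u‖ * (‖μ‖ * (√T * r * (‖μ‖ * M)))
        ≤ √T * r * (‖μ‖ * (√T * r * (‖μ‖ * M))) := by gcongr
      _ = (√T * √T) * (‖μ‖ ^ 2 * r ^ 2 * M) := by ring
      _ = ‖μ‖ ^ 2 * ‖φ₀‖ * T * r ^ 2 / (1 - ‖μ‖ * √T * r) := by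
        rw [Real.mul_self_sqrt hT, hM]; ring

end Control

/-! ### Widths under affine approximation. -/

section Width

variable {𝕜 X Y : Type*} [NormedField 𝕜] [NormedAlgebra ℝ 𝕜] [NormedAddCommGroup X]
  [NormedSpace ℝ X] [NormedAddCommGroup Y] [NormedSpace ℝ Y] [NormedSpace 𝕜 Y]
  [IsScalarTower ℝ 𝕜 Y]

/-- The map is only real linear, yet the images of a real basis of `V` span over `𝕜`, so the
dimension over `𝕜` does not exceed the real dimension of `V`. This treats the real and the complex
width of the reachable set together. -/
theorem Submodule.finiteDimensional_span_image_and_finrank_le (L : X →ₗ[ℝ] Y) (V : Submodule ℝ X)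
    [FiniteDimensional ℝ V] :
    FiniteDimensional 𝕜 (Submodule.span 𝕜 (L '' V)) ∧
      Module.finrank 𝕜 (Submodule.span 𝕜 (L '' V)) ≤ Module.finrank ℝ V := by
  set b := Module.finBasis ℝ V
  have hle : Submodule.span 𝕜 (L '' V)
      ≤ Submodule.span 𝕜 (range fun i => L (b i : X)) := by
    rw [Submodule.span_le]
    rintro _ ⟨x, hx, rfl⟩
    have h := congrArg (fun v : V => L (v : X)) (b.sum_repr ⟨x, hx⟩)
    simp only [Submodule.coe_sum, Submodule.coe_smul, map_sum, map_smul] at h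
    rw [← h]
    exact Submodule.sum_mem _ fun i _ =>
      Submodule.smul_of_tower_mem _ _ (Submodule.subset_span (mem_range_self i))
  have hfin : FiniteDimensional 𝕜 (Submodule.span 𝕜 (range fun i => L (b i : X))) :=
    FiniteDimensional.span_of_finite 𝕜 (finite_range _)
  refine ⟨Submodule.finiteDimensional_of_le hle, (Submodule.finrank_mono hle).trans ?_⟩
  exact (finrank_range_le_card (R := 𝕜) fun i => L (b i : X)).trans_eq (by simp)

/-- A set that is approximated by the image of `K` under an affine map of Lipschitz constant `C`
up to an error `R` has width at most `C` times the width of `K` plus `R`. -/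
theorem affineWidth_le_of_affine_approx (L : X →ₗ[ℝ] Y) (p : Y) {C R : ℝ} (hC : 0 ≤ C)
    (hL : ∀ x, ‖L x‖ ≤ C * ‖x‖) {S : Set Y} {K : Set X}
    (hS : ∀ y ∈ S, ∃ u ∈ K, ‖y - (p + L u)‖ ≤ R) (n : ℕ) :
    affineWidth 𝕜 n S ≤ ENNReal.ofReal C * affineWidth ℝ n K + ENNReal.ofReal R := by
  set P : AffineSubspace ℝ X → Prop := fun W => (W : Set X).Nonempty ∧
      FiniteDimensional ℝ W.direction ∧ Module.finrank ℝ W.direction ≤ n with hP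
  -- Multiplication by `ENNReal.ofReal C` commutes with the infimum even for `C = 0` only if the
  -- index set is nonempty, as `0 * ∞ = 0`. The point `{0}` is an admissible subspace.
  have hne : Nonempty {W // P W} :=
    ⟨⟨AffineSubspace.mk' 0 ⊥, ⟨0, AffineSubspace.self_mem_mk' _ _⟩, by
      rw [AffineSubspace.direction_mk']
      exact ⟨inferInstance, by simp⟩⟩⟩
  have hw : affineWidth ℝ n K
      = ⨅ W : {W // P W}, ⨆ x ∈ K, ⨅ ξ ∈ W.1, ‖x - ξ‖ₑ := iInf_subtype'
  rw [hw, ENNReal.mul_iInf (fun h => absurd h ENNReal.ofReal_ne_top), ENNReal.iInf_add]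
  refine le_iInf fun ⟨W, ⟨w₀, hw₀⟩, hfd, hrank⟩ => ?_
  obtain ⟨hfd', hrank'⟩ :=
    Submodule.finiteDimensional_span_image_and_finrank_le (𝕜 := 𝕜) L W.direction
  -- This subspace may exceed the image of `W`; it suffices that it contains `p + L ξ` for every `ξ
  -- ∈ W`.
  refine (iInf₂_le (AffineSubspace.mk' (p + L w₀) (Submodule.span 𝕜 (L '' W.direction)))
    ⟨⟨_, AffineSubspace.self_mem_mk' _ _⟩, by
      rw [AffineSubspace.direction_mk']
      exact ⟨hfd', hrank'.trans hrank⟩⟩).trans ?_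
  refine iSup₂_le fun y hy => ?_
  obtain ⟨u, hu, hyu⟩ := hS y hy
  refine le_trans ?_ (add_le_add_left (mul_le_mul_right
    (le_iSup₂ (f := fun x (_ : x ∈ K) => ⨅ ξ ∈ W, ‖x - ξ‖ₑ) u hu) _) _)
  have : Nonempty W := ⟨⟨w₀, hw₀⟩⟩
  have hi : (⨅ ξ ∈ W, ‖u - ξ‖ₑ) = ⨅ ξ : W, ‖u - ξ‖ₑ := iInf_subtype'
  rw [hi, ENNReal.mul_iInf (fun h => absurd h ENNReal.ofReal_ne_top), ENNReal.iInf_add]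
  refine le_iInf fun ⟨ξ, hξ⟩ => ?_
  refine (iInf₂_le (p + L ξ) ?_).trans ?_
  · rw [AffineSubspace.mem_mk', vsub_eq_sub, add_sub_add_left_eq_sub, ← map_sub]
    exact Submodule.subset_span ⟨_, AffineSubspace.vsub_mem_direction hξ hw₀, rfl⟩
  · have h1 : ‖y - (p + L ξ)‖ ≤ C * ‖u - ξ‖ + R := by
      have e : y - (p + L ξ) = L (u - ξ) + (y - (p + L u)) := by rw [map_sub]; abel
      rw [e]
      exact (norm_add_le _ _).trans (add_le_add (hL _) hyu)
    have hR : 0 ≤ R := (norm_nonneg _).trans hyu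
    rw [← ofReal_norm, ← ofReal_norm, ← ENNReal.ofReal_mul hC,
      ← ENNReal.ofReal_add (by positivity) hR]
    exact ENNReal.ofReal_le_ofReal h1

end Width

/-! ### The width estimate for the reachable set. -/

theorem corollary2 (μ : PotentialSpace) (T r : ℝ) (hT : 0 < T) (K : Set (ControlSpace T))
    (hK : K.Nonempty) (hKr : ∀ u ∈ K, ‖u‖ ≤ r) (hTr : T * (‖μ‖ ^ 2 * r ^ 2) < 1)
    (φ₀ : StateSpace) (n : ℕ) :
    affineWidth ℝ n (reachableSet μ T K φ₀) ≤
        ENNReal.ofReal (‖μ‖ * ‖φ₀‖ * √T) * affineWidth ℝ n K +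
          ENNReal.ofReal (‖μ‖ ^ 2 * ‖φ₀‖ * T * r ^ 2 / (1 - ‖μ‖ * √T * r)) ∧
      affineWidth ℂ n (reachableSet μ T K φ₀) ≤
        ENNReal.ofReal (‖μ‖ * ‖φ₀‖ * √T) * affineWidth ℝ n K +
          ENNReal.ofReal (‖μ‖ ^ 2 * ‖φ₀‖ * T * r ^ 2 / (1 - ‖μ‖ * √T * r)) := by
  have hr0 : 0 ≤ r := by
    obtain ⟨u, hu⟩ := hK
    exact (norm_nonneg u).trans (hKr u hu)
  have hr : ‖μ‖ * √T * r < 1 := by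
    have h1 : (‖μ‖ * √T * r) ^ 2 < 1 := by
      rw [mul_pow, mul_pow, Real.sq_sqrt hT.le]
      linarith
    exact (sq_lt_one_iff₀ (by positivity)).1 h1
  set L : ControlSpace T →ₗ[ℝ] StateSpace :=
    ((freeGroup T).toLinearEquiv.toLinearMap.restrictScalars ℝ) ∘ₗ firstOrderMap T μ φ₀
  have hLa : ∀ u, L u = freeGroup T (firstOrderMap T μ φ₀ u) := fun u => rfl
  have hL : ∀ u, ‖L u‖ ≤ ‖μ‖ * ‖φ₀‖ * √T * ‖u‖ := fun u => by
    rw [hLa, LinearIsometryEquiv.norm_map]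
    exact norm_firstOrderMap_le hT.le μ φ₀ u
  have hS : ∀ y ∈ reachableSet μ T K φ₀, ∃ u ∈ K, ‖y - (freeGroup T φ₀ + L u)‖
      ≤ ‖μ‖ ^ 2 * ‖φ₀‖ * T * r ^ 2 / (1 - ‖μ‖ * √T * r) := by
    rintro _ ⟨u, hu, φ, hφ, rfl⟩
    exact ⟨u, hu, hφ.norm_sub_firstOrder_le hT.le (hKr u hu) hr⟩
  exact ⟨affineWidth_le_of_affine_approx L _ (by positivity) hL hS n,
    affineWidth_le_of_affine_approx L _ (by positivity) hL hS n⟩
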